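/- Let $d\ge 2$, let $\theta$ be a real skew-symmetric $d\times d$ matrix, and let $\mathbb T_\theta^d$ be the quantum torus: the von Neumann algebra generated by unitaries $U_1,\dots,U_d$ with $U_kU_j=e^{2\pi i\theta_{kj}}U_jU_k$ in the GNS representation of its canonical trace $\tau$, where $\tau(U^m)=\delta_{m,0}$ for $U^m=U_1^{m_1}\cdots U_d^{m_d}$, $m\in\mathbb Z^d$. Write $L^2(\mathbb T_\theta^d)$ and $L^2(\mathbb T_\theta^d\otimes(\mathbb T_\theta^d)^{\rm op})$ for the $L^2$-spaces with respect to $\tau$ and $\tau\otimes\tau$. Let $J^\alpha$ be the Bessel potential, i.e. the Fourier multiplier $U^m\mapsto(1+|m|^2)^{\alpha/2}U^m$, $|m|$ the Euclidean norm. Let $\alpha_1,\alpha_2\ge 0$ and let $k\in H^{\alpha_1,\alpha_2}(\mathbb T_\theta^d\otimes(\mathbb T_\theta^d)^{\rm op})$, that is, $k\in L^2(\mathbb T_\theta^d\otimes(\mathbb T_\theta^d)^{\rm op})$ and $(J^{\alpha_1}\otimes J^{\alpha_2})k\in L^2(\mathbb T_\theta^d\otimes(\mathbb T_\theta^d)^{\rm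 op})$. Let $T_k$ be the integral operator with kernel $k$, i.e. the bounded operator on $L^2(\mathbb T_\theta^d)$ that extends $$T_k(x)=(\mathrm{id}\otimes\tau)\bigl(k(1\otimes x)\bigr)=(\mathrm{id}\otimes\tau)\bigl((1\otimes x)k\bigr),\qquad x\in\mathbb T_\theta^d,$$ (the two expressions coincide). Then $T_k$ belongs to the Schatten class $S_r(L^2(\mathbb T_\theta^d))$ for every real $$r>\frac{2d}{d+2(\alpha_1+\alpha_2)},$$ that is, $T_k$ is compact and $\sum_{n\ge 0}\mu(n,T_k)^r<\infty$, where $\mu(n,T)=\inf\{\|T-R\|:\operatorname{rank}R\le n\}$. -/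

import Mathlib

open scoped TensorProduct InnerProductSpace ComplexConjugate

noncomputable section

set_option linter.unusedSectionVars false

namespace NCTorus

/-! ### Tracial states and their `L²` spaces -/

/-- A tracial state on a unital complex `*`-algebra for which all multiplication operators are
bounded in the 2-norm (the last field is automatic on a C*-algebra). -/
structure TracialState (A : Type*) [Ring A] [StarRing A] [Algebra ℂ A] [StarModule ℂ A] where
  toLin : A →ₗ[ℂ] ℂ
  map_one : toLin 1 = 1
  map_star : ∀ a, toLin (star a) = conj (toLin a)
  trace : ∀ a b, toLin (a * b) = toLin (b * a)
  nonneg : ∀ a, 0 ≤ (toLin (star a * a)).re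
  bounded : ∀ a, ∃ C : ℝ, ∀ b,
    (toLin (star (a * b) * (a * b))).re ≤ C * (toLin (star b * b)).re

namespace TracialState

section General

variable {A : Type*} [Ring A] [StarRing A] [Algebra ℂ A] [StarModule ℂ A]

/-- The algebra `A` regarded as a pre-Hilbert space for `⟪a, b⟫ = τ (a* b)`. -/
def PreL2 (_τ : TracialState A) : Type _ := A

variable (τ : TracialState A)

instance : AddCommGroup τ.PreL2 := inferInstanceAs (AddCommGroup A)
instance : Module ℂ τ.PreL2 := inferInstanceAs (Module ℂ A)

/-- The identity map from `A` to the pre-Hilbert space. -/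
def toPre : A ≃ₗ[ℂ] τ.PreL2 := LinearEquiv.refl ℂ A

/-- The inner product `⟪a, b⟫ = τ (a* b)`. -/
abbrev preCore : PreInnerProductSpace.Core ℂ τ.PreL2 where
  inner a b := τ.toLin (star (τ.toPre.symm a) * τ.toPre.symm b)
  conj_inner_symm a b := by rw [← τ.map_star]; simp
  re_inner_nonneg a := τ.nonneg _
  add_left a b c := by simp [add_mul]
  smul_left a b c := by simp

instance : SeminormedAddCommGroup τ.PreL2 :=
  InnerProductSpace.Core.toSeminormedAddCommGroup (c := τ.preCore)
instance : InnerProductSpace ℂ τ.PreL2 := InnerProductSpace.ofCore τ.preCore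

theorem inner_toPre (a b : A) : ⟪τ.toPre a, τ.toPre b⟫_ℂ = τ.toLin (star a * b) := rfl

theorem norm_toPre_sq (a : A) : ‖τ.toPre a‖ ^ 2 = (τ.toLin (star a * a)).re := by
  rw [← inner_toPre, ← RCLike.re_eq_complex_re, inner_self_eq_norm_sq]

/-- The Hilbert space `L²(A, τ)`. -/
abbrev L2 : Type _ := UniformSpace.Completion τ.PreL2

/-- The canonical map `A → L²(A, τ)`. -/
def incl : A →ₗ[ℂ] τ.L2 :=
  (UniformSpace.Completion.toComplL (𝕜 := ℂ) (E := τ.PreL2)).toLinearMap ∘ₗ τ.toPre.toLinearMap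

theorem incl_apply (a : A) : τ.incl a = ((τ.toPre a : τ.PreL2) : τ.L2) := rfl

theorem inner_incl (a b : A) : ⟪τ.incl a, τ.incl b⟫_ℂ = τ.toLin (star a * b) := by
  rw [incl_apply, incl_apply, UniformSpace.Completion.inner_coe, inner_toPre]

theorem norm_incl (a : A) : ‖τ.incl a‖ = ‖τ.toPre a‖ := by
  rw [incl_apply, UniformSpace.Completion.norm_coe]

theorem bound_of_sq {C x y : ℝ} (hy : 0 ≤ y) (h : x ^ 2 ≤ C * y ^ 2) :
    x ≤ Real.sqrt (max C 0) * y := by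
  apply le_of_sq_le_sq _ (by positivity)
  rw [mul_pow, Real.sq_sqrt (le_max_right _ _)]
  exact h.trans (mul_le_mul_of_nonneg_right (le_max_left _ _) (by positivity))

theorem norm_toPre_star (a : A) : ‖τ.toPre (star a)‖ = ‖τ.toPre a‖ := by
  rw [← sq_eq_sq₀ (norm_nonneg _) (norm_nonneg _), norm_toPre_sq, norm_toPre_sq, τ.trace, star_star]

theorem exists_lmul_bound (a : A) :
    ∃ C : ℝ, ∀ b : A, ‖τ.toPre (a * b)‖ ≤ C * ‖τ.toPre b‖ := by
  obtain ⟨C, hC⟩ := τ.bounded a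
  refine ⟨Real.sqrt (max C 0), fun b => bound_of_sq (norm_nonneg _) ?_⟩
  rw [norm_toPre_sq, norm_toPre_sq]
  exact hC b

theorem exists_rmul_bound (a : A) :
    ∃ C : ℝ, ∀ b : A, ‖τ.toPre (b * a)‖ ≤ C * ‖τ.toPre b‖ := by
  obtain ⟨C, hC⟩ := τ.exists_lmul_bound (star a)
  refine ⟨C, fun b => ?_⟩
  rw [← norm_toPre_star, star_mul, ← τ.norm_toPre_star b]
  exact hC _

/-- The bounded operator `ξ ↦ a ξ` on `L²(A, τ)`. -/
def lmul (a : A) : τ.L2 →L[ℂ] τ.L2 :=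
  ((τ.toPre.toLinearMap ∘ₗ LinearMap.mulLeft ℂ a ∘ₗ
    τ.toPre.symm.toLinearMap).mkContinuousOfExistsBound (by
      obtain ⟨C, hC⟩ := τ.exists_lmul_bound a
      exact ⟨C, fun x => hC (τ.toPre.symm x)⟩)).completion

/-- The bounded operator `ξ ↦ ξ a` on `L²(A, τ)`. -/
def rmul (a : A) : τ.L2 →L[ℂ] τ.L2 :=
  ((τ.toPre.toLinearMap ∘ₗ LinearMap.mulRight ℂ a ∘ₗ
    τ.toPre.symm.toLinearMap).mkContinuousOfExistsBound (by
      obtain ⟨C, hC⟩ := τ.exists_rmul_bound a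
      exact ⟨C, fun x => hC (τ.toPre.symm x)⟩)).completion

theorem lmul_incl (a b : A) : τ.lmul a (τ.incl b) = τ.incl (a * b) := by
  rw [incl_apply, lmul, ContinuousLinearMap.completion_apply_coe]; rfl

theorem rmul_incl (a b : A) : τ.rmul a (τ.incl b) = τ.incl (b * a) := by
  rw [incl_apply, rmul, ContinuousLinearMap.completion_apply_coe]; rfl

theorem ext_L2 {E : Type*} [NormedAddCommGroup E] [NormedSpace ℂ E] {S T : τ.L2 →L[ℂ] E}
    (h : ∀ a, S (τ.incl a) = T (τ.incl a)) : S = T := by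
  ext x
  induction x using UniformSpace.Completion.induction_on with
  | hp => exact isClosed_eq S.continuous T.continuous
  | ih a => exact h (τ.toPre.symm a)

/-- The same functional on the opposite algebra. -/
def op : TracialState Aᵐᵒᵖ where
  toLin := τ.toLin ∘ₗ (MulOpposite.opLinearEquiv ℂ (M := A)).symm.toLinearMap
  map_one := by simp [τ.map_one]
  map_star a := by simp [τ.map_star]
  trace a b := by simp [τ.trace a.unop]
  nonneg a := by
    have := τ.nonneg a.unop
    rw [τ.trace] at this
    simpa using this
  bounded a := by
    obtain ⟨C, hC⟩ := τ.bounded (star a.unop)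
    refine ⟨C, fun b => ?_⟩
    have := hC (star b.unop)
    simpa [mul_assoc] using this

theorem op_apply (a : A) : τ.op.toLin (MulOpposite.op a) = τ.toLin a := rfl

end General

section Tensor

variable {A : Type*} [Ring A] [StarRing A] [Algebra ℂ A] [StarModule ℂ A]
variable {B : Type*} [Ring B] [StarRing B] [Algebra ℂ B] [StarModule ℂ B]
variable (φ : TracialState A) (ψ : TracialState B)

/-- The functional `φ ⊗ ψ` on the algebraic tensor product. -/
def tensorLin : A ⊗[ℂ] B →ₗ[ℂ] ℂ :=
  LinearMap.mul' ℂ ℂ ∘ₗ TensorProduct.map φ.toLin ψ.toLin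

theorem tensorLin_tmul (a : A) (b : B) :
    tensorLin φ ψ (a ⊗ₜ b) = φ.toLin a * ψ.toLin b := by
  simp [tensorLin]

/-- The map `A ⊗ B → L²(A) ⊗ L²(B)`. -/
def tensorEmb : A ⊗[ℂ] B →ₗ[ℂ] φ.L2 ⊗[ℂ] ψ.L2 := TensorProduct.map φ.incl ψ.incl

theorem tensorLin_star_mul (x y : A ⊗[ℂ] B) :
    tensorLin φ ψ (star x * y) = ⟪tensorEmb φ ψ x, tensorEmb φ ψ y⟫_ℂ := by
  induction x using TensorProduct.induction_on with
  | zero => simp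
  | add x₁ x₂ h₁ h₂ => simp [add_mul, inner_add_left, h₁, h₂]
  | tmul a b =>
    induction y using TensorProduct.induction_on with
    | zero => simp
    | add y₁ y₂ h₁ h₂ => rw [mul_add, map_add, map_add, inner_add_right, h₁, h₂]
    | tmul c d => simp [tensorLin_tmul, tensorEmb, inner_incl]

theorem tensorLin_star_mul_self (x : A ⊗[ℂ] B) :
    (tensorLin φ ψ (star x * x)).re = ‖tensorEmb φ ψ x‖ ^ 2 := by
  rw [tensorLin_star_mul]
  exact inner_self_eq_norm_sq (𝕜 := ℂ) (tensorEmb φ ψ x)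

theorem exists_tensor_lmul (a : A ⊗[ℂ] B) :
    ∃ S : φ.L2 ⊗[ℂ] ψ.L2 →L[ℂ] φ.L2 ⊗[ℂ] ψ.L2, ∀ x : A ⊗[ℂ] B,
      tensorEmb φ ψ (a * x) = S (tensorEmb φ ψ x) := by
  induction a using TensorProduct.induction_on with
  | zero => exact ⟨0, fun x => by simp⟩
  | add a₁ a₂ h₁ h₂ =>
    obtain ⟨S₁, h₁⟩ := h₁
    obtain ⟨S₂, h₂⟩ := h₂
    exact ⟨S₁ + S₂, fun x => by simp [add_mul, h₁, h₂]⟩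
  | tmul a b =>
    refine ⟨TensorProduct.mapL (φ.lmul a) (ψ.lmul b), fun x => ?_⟩
    induction x using TensorProduct.induction_on with
    | zero => simp
    | add x₁ x₂ h₁ h₂ => rw [mul_add, map_add, map_add, map_add, h₁, h₂]
    | tmul c d => simp [tensorEmb, lmul_incl]

/-- The tracial state `φ ⊗ ψ` on the algebraic tensor product. The Hilbert space
`(φ.tensor ψ).L2` is the `L²` space of the tensor product of the two tracial algebras: the
algebraic tensor product is dense, for the 2-norm, in the von Neumann algebra tensor product. -/
def tensor : TracialState (A ⊗[ℂ] B) where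
  toLin := tensorLin φ ψ
  map_one := by
    rw [Algebra.TensorProduct.one_def, tensorLin_tmul, φ.map_one, ψ.map_one, one_mul]
  map_star x := by
    have h := tensorLin_star_mul φ ψ x 1
    have h' := tensorLin_star_mul φ ψ 1 x
    rw [mul_one] at h
    rw [star_one, one_mul] at h'
    rw [h, h']
    exact (inner_conj_symm (𝕜 := ℂ) (tensorEmb φ ψ x) (tensorEmb φ ψ 1)).symm
  trace x y := by
    induction x using TensorProduct.induction_on with
    | zero => simp
    | add x₁ x₂ h₁ h₂ => rw [add_mul, mul_add, map_add, map_add, h₁, h₂]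
    | tmul a b =>
      induction y using TensorProduct.induction_on with
      | zero => simp
      | add y₁ y₂ h₁ h₂ => rw [add_mul, mul_add, map_add, map_add, h₁, h₂]
      | tmul c d =>
        simp only [Algebra.TensorProduct.tmul_mul_tmul, tensorLin_tmul]
        rw [φ.trace, ψ.trace]
  nonneg x := by
    rw [tensorLin_star_mul_self]
    positivity
  bounded a := by
    obtain ⟨S, hS⟩ := exists_tensor_lmul φ ψ a
    refine ⟨‖S‖ ^ 2, fun x => ?_⟩
    rw [tensorLin_star_mul_self, tensorLin_star_mul_self, hS, ← mul_pow]
    exact pow_le_pow_left₀ (norm_nonneg _) (S.le_opNorm _) 2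

/-- The slice map `id ⊗ ψ : a ⊗ b ↦ ψ(b) a`. -/
def sliceLin : A ⊗[ℂ] B →ₗ[ℂ] A :=
  (TensorProduct.rid ℂ A).toLinearMap ∘ₗ TensorProduct.map LinearMap.id ψ.toLin

theorem sliceLin_tmul (a : A) (b : B) : sliceLin (A := A) ψ (a ⊗ₜ b) = ψ.toLin b • a := by
  simp [sliceLin]

theorem inner_sliceLin (c : A) (x : A ⊗[ℂ] B) :
    φ.toLin (c * sliceLin ψ x) = (φ.tensor ψ).toLin ((c ⊗ₜ[ℂ] (1 : B)) * x) := by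
  change _ = tensorLin φ ψ _
  induction x using TensorProduct.induction_on with
  | zero => simp
  | add x₁ x₂ h₁ h₂ => rw [map_add, mul_add, mul_add, map_add, map_add, h₁, h₂]
  | tmul a b => simp [sliceLin_tmul, tensorLin_tmul, mul_comm]

theorem norm_tmul_toPre (a : A) (b : B) :
    ‖(φ.tensor ψ).toPre (a ⊗ₜ[ℂ] b)‖ = ‖φ.toPre a‖ * ‖ψ.toPre b‖ := by
  rw [← sq_eq_sq₀ (norm_nonneg _) (by positivity), norm_toPre_sq]
  change (tensorLin φ ψ _).re = _
  rw [tensorLin_star_mul_self]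
  simp [tensorEmb, norm_incl]

theorem norm_one_toPre : ‖φ.toPre 1‖ = 1 := by
  rw [← sq_eq_sq₀ (norm_nonneg _) zero_le_one, norm_toPre_sq]
  simp [φ.map_one]

theorem norm_sliceLin_le (x : A ⊗[ℂ] B) :
    ‖φ.toPre (sliceLin ψ x)‖ ≤ 1 * ‖(φ.tensor ψ).toPre x‖ := by
  set z := sliceLin ψ x with hz
  have h : ‖φ.toPre z‖ * ‖φ.toPre z‖ ≤ ‖φ.toPre z‖ * ‖(φ.tensor ψ).toPre x‖ := by
    calc ‖φ.toPre z‖ * ‖φ.toPre z‖ = (φ.toLin (star z * z)).re := by rw [← norm_toPre_sq, sq]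
      _ = (⟪(φ.tensor ψ).toPre (z ⊗ₜ[ℂ] (1 : B)), (φ.tensor ψ).toPre x⟫_ℂ).re := by
          rw [inner_toPre]
          nth_rw 2 [hz]
          rw [inner_sliceLin]
          simp
      _ ≤ ‖(φ.tensor ψ).toPre (z ⊗ₜ[ℂ] (1 : B))‖ * ‖(φ.tensor ψ).toPre x‖ :=
          re_inner_le_norm (𝕜 := ℂ) _ _
      _ = ‖φ.toPre z‖ * ‖(φ.tensor ψ).toPre x‖ := by
          rw [norm_tmul_toPre, norm_one_toPre, mul_one]
  rcases (norm_nonneg (φ.toPre z)).eq_or_lt with h0 | h0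
  · rw [← h0, one_mul]; exact norm_nonneg _
  · rw [one_mul]; exact le_of_mul_le_mul_left h h0

/-- The slice map `id ⊗ ψ : L²(A ⊗ B) → L²(A)`, the continuous extension of
`a ⊗ b ↦ ψ(b) a`. -/
def slice : (φ.tensor ψ).L2 →L[ℂ] φ.L2 :=
  ((φ.toPre.toLinearMap ∘ₗ sliceLin ψ ∘ₗ
    (φ.tensor ψ).toPre.symm.toLinearMap).mkContinuous 1
      (fun x => norm_sliceLin_le φ ψ ((φ.tensor ψ).toPre.symm x))).completion

theorem slice_incl (x : A ⊗[ℂ] B) :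
    slice φ ψ ((φ.tensor ψ).incl x) = φ.incl (sliceLin ψ x) := by
  rw [incl_apply, slice, ContinuousLinearMap.completion_apply_coe]; rfl

end Tensor

/-! ### Integral operators -/

section Kernel

variable {A : Type*} [Ring A] [StarRing A] [Algebra ℂ A] [StarModule ℂ A] (τ : TracialState A)

/-- The kernel space `L²(A ⊗ Aᵒᵖ)`. -/
abbrev KernelL2 : Type _ := (τ.tensor τ.op).L2

/-- The element `1 ⊗ x` of `A ⊗ Aᵒᵖ`. -/
def oneTensor : A →ₗ[ℂ] A ⊗[ℂ] Aᵐᵒᵖ :=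
  TensorProduct.mk ℂ A Aᵐᵒᵖ 1 ∘ₗ (MulOpposite.opLinearEquiv ℂ (M := A)).toLinearMap

theorem oneTensor_apply (x : A) :
    oneTensor x = (1 : A) ⊗ₜ[ℂ] MulOpposite.op x := rfl

/-- `(id ⊗ τ)(k (1 ⊗ x))` for a kernel `k` in `L²(A ⊗ Aᵒᵖ)` and `x ∈ A`. -/
def applyRight (k : τ.KernelL2) (x : A) : τ.L2 :=
  slice τ τ.op ((τ.tensor τ.op).rmul (oneTensor x) k)

/-- `(id ⊗ τ)((1 ⊗ x) k)` for a kernel `k` in `L²(A ⊗ Aᵒᵖ)` and `x ∈ A`. -/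
def applyLeft (k : τ.KernelL2) (x : A) : τ.L2 :=
  slice τ τ.op ((τ.tensor τ.op).lmul (oneTensor x) k)

theorem rmul_add (a b : A) (k : τ.L2) : τ.rmul (a + b) k = τ.rmul a k + τ.rmul b k := by
  have : τ.rmul (a + b) = τ.rmul a + τ.rmul b :=
    τ.ext_L2 fun c => by simp [rmul_incl, mul_add]
  rw [this]; rfl

theorem rmul_smul (c : ℂ) (a : A) (k : τ.L2) : τ.rmul (c • a) k = c • τ.rmul a k := by
  have : τ.rmul (c • a) = c • τ.rmul a :=
    τ.ext_L2 fun b => by simp [rmul_incl]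
  rw [this]; rfl

theorem norm_op_toPre_star (x : A) :
    ‖τ.op.toPre (MulOpposite.op (star x))‖ = ‖τ.toPre x‖ := by
  rw [← sq_eq_sq₀ (norm_nonneg _) (norm_nonneg _), norm_toPre_sq, norm_toPre_sq]
  simp [op]

theorem norm_applyRight_le (k : τ.KernelL2) (x : A) :
    ‖τ.applyRight k x‖ ≤ ‖k‖ * ‖τ.toPre x‖ := by
  induction k using UniformSpace.Completion.induction_on with
  | hp =>
    refine isClosed_le ?_ ?_
    · exact ((slice τ τ.op).continuous.comp
        ((τ.tensor τ.op).rmul (oneTensor x)).continuous).norm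
    · exact continuous_norm.mul continuous_const
  | ih k =>
    obtain ⟨k, rfl⟩ := (τ.tensor τ.op).toPre.surjective k
    rw [← incl_apply, applyRight, rmul_incl, slice_incl, norm_incl, norm_incl]
    set z := sliceLin τ.op (k * oneTensor x) with hz
    have key : τ.toLin (star z * z) =
        ⟪(τ.tensor τ.op).toPre (z ⊗ₜ[ℂ] MulOpposite.op (star x)), (τ.tensor τ.op).toPre k⟫_ℂ := by
      nth_rw 2 [hz]
      rw [inner_sliceLin, ← mul_assoc, TracialState.trace, ← mul_assoc, inner_toPre]
      simp [oneTensor_apply]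
    have h : ‖τ.toPre z‖ * ‖τ.toPre z‖ ≤
        ‖τ.toPre z‖ * (‖(τ.tensor τ.op).toPre k‖ * ‖τ.toPre x‖) := by
      calc ‖τ.toPre z‖ * ‖τ.toPre z‖ = (τ.toLin (star z * z)).re := by rw [← norm_toPre_sq, sq]
        _ ≤ ‖(τ.tensor τ.op).toPre (z ⊗ₜ[ℂ] MulOpposite.op (star x))‖ *
              ‖(τ.tensor τ.op).toPre k‖ := by
            rw [key]; exact re_inner_le_norm (𝕜 := ℂ) _ _
        _ = _ := by rw [norm_tmul_toPre, norm_op_toPre_star]; ring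
    rcases (norm_nonneg (τ.toPre z)).eq_or_lt with h0 | h0
    · rw [← h0]; positivity
    · exact le_of_mul_le_mul_left h h0

/-- The integral operator `T_k` on `L²(A, τ)`: the continuous extension to `L²` of
`x ↦ (id ⊗ τ)(k (1 ⊗ x))`, `x ∈ A`. -/
def integralOperator (k : τ.KernelL2) : τ.L2 →L[ℂ] τ.L2 :=
  (LinearMap.mkContinuous
    ({ toFun := fun x => τ.applyRight k (τ.toPre.symm x)
       map_add' := fun x y => by simp [applyRight, rmul_add]
       map_smul' := fun c x => by simp [applyRight, rmul_smul] } : τ.PreL2 →ₗ[ℂ] τ.L2)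
    ‖k‖ (fun x => τ.norm_applyRight_le k (τ.toPre.symm x))).fromCompletion

theorem integralOperator_incl (k : τ.KernelL2) (x : A) :
    τ.integralOperator k (τ.incl x) = τ.applyRight k x := by
  rw [incl_apply, integralOperator, ContinuousLinearMap.fromCompletion_apply_coe]; rfl

end Kernel

end TracialState

/-! ### Schatten classes -/

section Schatten

variable {H : Type*} [NormedAddCommGroup H] [InnerProductSpace ℂ H]

/-- The singular value `μ(n, T) = inf {‖T - R‖ : rank R ≤ n}`. -/
def singularValue (T : H →L[ℂ] H) (n : ℕ) : ℝ :=
  sInf {c : ℝ | ∃ R : H →L[ℂ] H, R.toLinearMap.rank ≤ (n : Cardinal) ∧ c = ‖T - R‖}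

/-- The Schatten class `S_p`, `0 < p < ∞`: compact operators with `p`-summable singular values. -/
def IsSchatten (p : ℝ) (T : H →L[ℂ] H) : Prop :=
  IsCompactOperator T ∧ Summable fun n : ℕ => singularValue T n ^ p

end Schatten

/-! ### The quantum torus -/

/-- The von Neumann algebra `(S ∪ S*)''` generated by a set of bounded operators. -/
def vonNeumannGenerated {H : Type*} [NormedAddCommGroup H] [InnerProductSpace ℂ H]
    [CompleteSpace H] (S : Set (H →L[ℂ] H)) : VonNeumannAlgebra H :=
  VonNeumannAlgebra.commutant
    { toStarSubalgebra := StarSubalgebra.centralizer ℂ S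
      centralizer_centralizer' := Set.centralizer_centralizer_centralizer (S ∪ star S) }

theorem subset_vonNeumannGenerated {H : Type*} [NormedAddCommGroup H] [InnerProductSpace ℂ H]
    [CompleteSpace H] (S : Set (H →L[ℂ] H)) {x : H →L[ℂ] H} (hx : x ∈ S) :
    x ∈ vonNeumannGenerated S := by
  rw [vonNeumannGenerated, VonNeumannAlgebra.mem_commutant_iff]
  intro g hg
  exact ((hg : g ∈ Set.centralizer (S ∪ star S)) x (Or.inl hx)).symm

theorem commute_of_mem_vonNeumannGenerated {H : Type*} [NormedAddCommGroup H]
    [InnerProductSpace ℂ H] [CompleteSpace H] {S : Set (H →L[ℂ] H)} {x : H →L[ℂ] H}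
    (hx : x ∈ vonNeumannGenerated S) {y : H →L[ℂ] H} (hy : y ∈ Set.centralizer (S ∪ star S)) :
    y * x = x * y := by
  rw [vonNeumannGenerated, VonNeumannAlgebra.mem_commutant_iff] at hx
  exact hx y hy

variable {d : ℕ}

/-- The Hilbert space `ℓ²(ℤᵈ)`. -/
abbrev Ell2 (d : ℕ) : Type := lp (fun _ : Fin d → ℤ => ℂ) 2

/-- The cocycle `σ(m, n) = exp (2πi ∑_{j < k} m_k θ_{kj} n_j)`. -/
def cocycle (θ : Matrix (Fin d) (Fin d) ℝ) (m n : Fin d → ℤ) : ℂ :=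
  Complex.exp (2 * Real.pi * Complex.I *
    ((∑ k, ∑ j ∈ Finset.univ.filter (· < k), (m k : ℝ) * θ k j * (n j : ℝ) : ℝ) : ℂ))

theorem norm_cocycle (θ : Matrix (Fin d) (Fin d) ℝ) (m n : Fin d → ℤ) : ‖cocycle θ m n‖ = 1 := by
  rw [cocycle, show ∀ r : ℝ, (2 * Real.pi * Complex.I * (r : ℂ)) =
    ((2 * Real.pi * r : ℝ) : ℂ) * Complex.I from fun r => by push_cast; ring]
  exact Complex.norm_exp_ofReal_mul_I _

theorem cocycle_add_left (θ : Matrix (Fin d) (Fin d) ℝ) (m m' n : Fin d → ℤ) :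
    cocycle θ (m + m') n = cocycle θ m n * cocycle θ m' n := by
  rw [cocycle, cocycle, cocycle, ← Complex.exp_add, ← mul_add, ← Complex.ofReal_add]
  simp only [Pi.add_apply, Int.cast_add, add_mul, Finset.sum_add_distrib]

theorem cocycle_add_right (θ : Matrix (Fin d) (Fin d) ℝ) (m n n' : Fin d → ℤ) :
    cocycle θ m (n + n') = cocycle θ m n * cocycle θ m n' := by
  rw [cocycle, cocycle, cocycle, ← Complex.exp_add, ← mul_add, ← Complex.ofReal_add]
  simp only [Pi.add_apply, Int.cast_add, mul_add, Finset.sum_add_distrib]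

/-- The operator `(g_n)_n ↦ (w_n g_{e n})_n` on `ℓ²`, for unimodular weights `w` and a
permutation `e` of the index set. -/
def weightedShift (w : (Fin d → ℤ) → ℂ) (hw : ∀ n, ‖w n‖ = 1) (e : (Fin d → ℤ) ≃ (Fin d → ℤ)) :
    Ell2 d →L[ℂ] Ell2 d :=
  LinearMap.mkContinuous
    { toFun := fun g => ⟨fun n => w n * g (e n), by
        have h := (lp.memℓp g).summable (by norm_num)
        refine memℓp_gen ?_
        simpa [hw, Function.comp_def] using e.summable_iff.mpr h⟩
      map_add' := fun g h => by ext n; exact mul_add _ _ _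
      map_smul' := fun c g => by ext n; simp; ring }
    1 (fun g => by
      rw [one_mul, lp.norm_eq_tsum_rpow (by norm_num), lp.norm_eq_tsum_rpow (by norm_num)]
      apply le_of_eq
      congr 1
      have := e.tsum_eq (fun n => ‖g n‖ ^ (2 : ENNReal).toReal)
      rw [← this]
      simp [hw])

theorem weightedShift_apply (w : (Fin d → ℤ) → ℂ) (hw : ∀ n, ‖w n‖ = 1)
    (e : (Fin d → ℤ) ≃ (Fin d → ℤ)) (g : Ell2 d) (n : Fin d → ℤ) :
    weightedShift w hw e g n = w n * g (e n) := rfl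

/-- The twisted translation `(λ(m) g)(n) = σ(m, n - m) g(n - m)`. -/
def lambda (θ : Matrix (Fin d) (Fin d) ℝ) (m : Fin d → ℤ) : Ell2 d →L[ℂ] Ell2 d :=
  weightedShift (fun n => cocycle θ m (n - m)) (fun _ => norm_cocycle _ _ _) (Equiv.subRight m)

theorem lambda_apply (θ : Matrix (Fin d) (Fin d) ℝ) (m : Fin d → ℤ) (g : Ell2 d)
    (n : Fin d → ℤ) : lambda θ m g n = cocycle θ m (n - m) * g (n - m) := rfl

/-- The projective representation identity `λ(m) λ(n) = σ(m, n) λ(m + n)`. -/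
theorem lambda_mul (θ : Matrix (Fin d) (Fin d) ℝ) (m n : Fin d → ℤ) :
    lambda θ m * lambda θ n = cocycle θ m n • lambda θ (m + n) := by
  ext g i
  change cocycle θ m (i - m) * (cocycle θ n (i - m - n) * g (i - m - n)) =
    cocycle θ m n * (cocycle θ (m + n) (i - (m + n)) * g (i - (m + n)))
  rw [show i - (m + n) = i - m - n by abel, cocycle_add_left,
    show cocycle θ m (i - m) = cocycle θ m n * cocycle θ m (i - m - n) by
      rw [← cocycle_add_right]; congr 1; abel]
  ring

/-- The quantum torus `𝕋_θ^d` as a von Neumann algebra on `ℓ²(ℤᵈ)`: the twisted group von Neumann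
algebra of `ℤᵈ`. -/
def quantumTorus (θ : Matrix (Fin d) (Fin d) ℝ) : VonNeumannAlgebra (Ell2 d) :=
  vonNeumannGenerated (Set.range (lambda θ))

/-- The `*`-algebra of elements of the quantum torus. -/
abbrev QTorus (θ : Matrix (Fin d) (Fin d) ℝ) : Type := ↥(quantumTorus θ).toStarSubalgebra

/-- The unitary `U^m = U_1^{m_1} ⋯ U_d^{m_d}`, realized as `λ(m)`. -/
def U (θ : Matrix (Fin d) (Fin d) ℝ) (m : Fin d → ℤ) : QTorus θ :=
  ⟨lambda θ m, subset_vonNeumannGenerated _ ⟨m, rfl⟩⟩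

theorem U_mul (θ : Matrix (Fin d) (Fin d) ℝ) (m n : Fin d → ℤ) :
    U θ m * U θ n = cocycle θ m n • U θ (m + n) :=
  Subtype.ext (lambda_mul θ m n)

/-- The defining relation `U_k U_j = exp (2πi θ_{kj}) U_j U_k` of the quantum torus, for the
generators `U_j = U^{e_j}` and a skew-symmetric `θ`. -/
theorem U_single_mul_comm (θ : Matrix (Fin d) (Fin d) ℝ) (hθ : θ.transpose = -θ) (k j : Fin d) :
    U θ (Pi.single k 1) * U θ (Pi.single j 1) =
      Complex.exp (2 * Real.pi * Complex.I * (θ k j : ℂ)) •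
        (U θ (Pi.single j 1) * U θ (Pi.single k 1)) := by
  have hsum : ∀ a b : Fin d, cocycle θ (Pi.single a 1) (Pi.single b 1) =
      Complex.exp (2 * Real.pi * Complex.I * ((if b < a then θ a b else 0 : ℝ) : ℂ)) := by
    intro a b
    rw [cocycle]
    congr 3
    rw [Finset.sum_eq_single a]
    · rw [Finset.sum_filter, Finset.sum_eq_single b]
      · simp
      · intro c _ hc
        simp [hc]
      · simp
    · intro c _ hc
      simp [hc]
    · simp
  have hskew : θ j k = - θ k j := by
    have := congrFun (congrFun hθ k) j
    simpa using this
  rw [U_mul, U_mul, smul_smul, add_comm (Pi.single j 1), hsum, hsum, ← Complex.exp_add]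
  congr 2
  rcases lt_trichotomy j k with h | h | h
  · simp [h, h.not_gt]
  · subst h
    have h0 : θ j j = 0 := by linarith
    simp [h0]
  · simp [h, h.not_gt, hskew]

/-- The basis vector `δ_n` of `ℓ²(ℤᵈ)`. -/
def delta (n : Fin d → ℤ) : Ell2 d := lp.single 2 n 1

theorem delta_apply (n i : Fin d → ℤ) : delta n i = if i = n then 1 else 0 := by
  simp [delta, lp.single_apply, Pi.single_apply]

theorem inner_delta_left (n : Fin d → ℤ) (f : Ell2 d) : ⟪delta n, f⟫_ℂ = f n := by
  rw [delta, lp.inner_single_left]; simp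

theorem inner_delta_right (n : Fin d → ℤ) (f : Ell2 d) : ⟪f, delta n⟫_ℂ = conj (f n) := by
  rw [← inner_conj_symm, inner_delta_left]

theorem cocycle_zero_left (θ : Matrix (Fin d) (Fin d) ℝ) (n : Fin d → ℤ) :
    cocycle θ 0 n = 1 := by simp [cocycle]

theorem cocycle_zero_right (θ : Matrix (Fin d) (Fin d) ℝ) (n : Fin d → ℤ) :
    cocycle θ n 0 = 1 := by simp [cocycle]

theorem cocycle_neg_comm (θ : Matrix (Fin d) (Fin d) ℝ) (n : Fin d → ℤ) :
    cocycle θ n (-n) = cocycle θ (-n) n := by simp [cocycle]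

theorem lambda_zero (θ : Matrix (Fin d) (Fin d) ℝ) : lambda θ 0 = 1 := by
  ext g i
  rw [lambda_apply, cocycle_zero_left, one_mul, sub_zero]; rfl

theorem norm_lambda_apply (θ : Matrix (Fin d) (Fin d) ℝ) (m : Fin d → ℤ) (g : Ell2 d) :
    ‖lambda θ m g‖ = ‖g‖ := by
  rw [lp.norm_eq_tsum_rpow (by norm_num), lp.norm_eq_tsum_rpow (by norm_num)]
  congr 1
  rw [← (Equiv.subRight m).tsum_eq (fun n => ‖g n‖ ^ (2 : ENNReal).toReal)]
  simp [lambda_apply, norm_cocycle]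

theorem star_lambda (θ : Matrix (Fin d) (Fin d) ℝ) (m : Fin d → ℤ) :
    star (lambda θ m) = (cocycle θ m (-m))⁻¹ • lambda θ (-m) := by
  have h1 : star (lambda θ m) * lambda θ m = 1 :=
    ContinuousLinearMap.norm_map_iff_adjoint_comp_self _ |>.mp (norm_lambda_apply θ m)
  have hc : cocycle θ m (-m) ≠ 0 := by
    rw [← norm_ne_zero_iff, norm_cocycle]; exact one_ne_zero
  have h2 : lambda θ m * ((cocycle θ m (-m))⁻¹ • lambda θ (-m)) = 1 := by
    rw [mul_smul_comm, lambda_mul, add_neg_cancel, lambda_zero, smul_smul, inv_mul_cancel₀ hc,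
      one_smul]
  calc star (lambda θ m)
      = star (lambda θ m) * (lambda θ m * ((cocycle θ m (-m))⁻¹ • lambda θ (-m))) := by
        rw [h2, mul_one]
    _ = _ := by rw [← mul_assoc, h1, one_mul]

/-- The right twisted translation `(ρ(m) g)(n) = σ(n - m, m) g(n - m)`, which commutes with the
quantum torus. -/
def rho (θ : Matrix (Fin d) (Fin d) ℝ) (m : Fin d → ℤ) : Ell2 d →L[ℂ] Ell2 d :=
  weightedShift (fun n => cocycle θ (n - m) m) (fun _ => norm_cocycle _ _ _) (Equiv.subRight m)

theorem rho_apply (θ : Matrix (Fin d) (Fin d) ℝ) (m : Fin d → ℤ) (g : Ell2 d)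
    (n : Fin d → ℤ) : rho θ m g n = cocycle θ (n - m) m * g (n - m) := rfl

theorem rho_delta_zero (θ : Matrix (Fin d) (Fin d) ℝ) (m : Fin d → ℤ) :
    rho θ m (delta 0) = delta m := by
  ext n
  rw [rho_apply, delta_apply, delta_apply]
  by_cases h : n = m
  · simp [h, cocycle_zero_left]
  · simp [h, sub_eq_zero]

theorem lambda_mul_rho (θ : Matrix (Fin d) (Fin d) ℝ) (m n : Fin d → ℤ) :
    lambda θ m * rho θ n = rho θ n * lambda θ m := by
  ext g i
  change cocycle θ m (i - m) * (cocycle θ (i - m - n) n * g (i - m - n)) =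
    cocycle θ (i - n) n * (cocycle θ m (i - n - m) * g (i - n - m))
  rw [show i - n - m = i - m - n by abel,
    show cocycle θ m (i - m) = cocycle θ m (i - m - n) * cocycle θ m n by
      rw [← cocycle_add_right]; congr 1; abel,
    show cocycle θ (i - n) n = cocycle θ (i - m - n) n * cocycle θ m n by
      rw [← cocycle_add_left]; congr 1; abel]
  ring

theorem mul_rho (θ : Matrix (Fin d) (Fin d) ℝ) (x : QTorus θ) (n : Fin d → ℤ) :
    rho θ n * (x : Ell2 d →L[ℂ] Ell2 d) = (x : Ell2 d →L[ℂ] Ell2 d) * rho θ n := by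
  refine commute_of_mem_vonNeumannGenerated (S := Set.range (lambda θ)) x.2 ?_
  rintro y (⟨m, rfl⟩ | hy)
  · exact lambda_mul_rho θ m n
  · obtain ⟨m, hm⟩ := hy
    have : y = star (lambda θ m) := by rw [hm, star_star]
    rw [this, star_lambda, smul_mul_assoc, mul_smul_comm, lambda_mul_rho]

theorem apply_delta (θ : Matrix (Fin d) (Fin d) ℝ) (x : QTorus θ) (n i : Fin d → ℤ) :
    (x : Ell2 d →L[ℂ] Ell2 d) (delta n) i =
      cocycle θ (i - n) n * (x : Ell2 d →L[ℂ] Ell2 d) (delta 0) (i - n) := by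
  rw [← rho_delta_zero θ n]
  change ((x : Ell2 d →L[ℂ] Ell2 d) * rho θ n) (delta 0) i = _
  rw [← mul_rho]
  rfl

theorem inner_delta_mul (θ : Matrix (Fin d) (Fin d) ℝ) (x y : QTorus θ) :
    ⟪delta 0, (x : Ell2 d →L[ℂ] Ell2 d) ((y : Ell2 d →L[ℂ] Ell2 d) (delta 0))⟫_ℂ =
      ∑' n : Fin d → ℤ, cocycle θ (-n) n * (x : Ell2 d →L[ℂ] Ell2 d) (delta 0) (-n) *
        (y : Ell2 d →L[ℂ] Ell2 d) (delta 0) n := by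
  rw [← ContinuousLinearMap.adjoint_inner_left, lp.inner_eq_tsum]
  refine tsum_congr fun n => ?_
  have h : conj ((ContinuousLinearMap.adjoint (x : Ell2 d →L[ℂ] Ell2 d)) (delta 0) n) =
      cocycle θ (-n) n * (x : Ell2 d →L[ℂ] Ell2 d) (delta 0) (-n) := by
    rw [← inner_delta_right, ContinuousLinearMap.adjoint_inner_left, inner_delta_left,
      apply_delta, zero_sub]
  rw [← h, RCLike.inner_apply, mul_comm]

/-- The canonical trace `τ(x) = ⟨x δ_0, δ_0⟩` of the quantum torus (the inner product of Mathlib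
is conjugate linear in the first variable). -/
def torusTrace (θ : Matrix (Fin d) (Fin d) ℝ) : TracialState (QTorus θ) where
  toLin :=
    { toFun := fun x => ⟪delta 0, (x : Ell2 d →L[ℂ] Ell2 d) (delta 0)⟫_ℂ
      map_add' := fun x y => inner_add_right _ _ _
      map_smul' := fun c x => inner_smul_right _ _ _ }
  map_one := by
    change ⟪delta 0, delta 0⟫_ℂ = 1
    rw [inner_delta_left, delta_apply, if_pos rfl]
  map_star x := by
    change ⟪delta 0, ContinuousLinearMap.adjoint (x : Ell2 d →L[ℂ] Ell2 d) (delta 0)⟫_ℂ =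
      conj ⟪delta 0, (x : Ell2 d →L[ℂ] Ell2 d) (delta 0)⟫_ℂ
    rw [ContinuousLinearMap.adjoint_inner_right, inner_conj_symm]
  trace x y := by
    change ⟪delta 0, (x : Ell2 d →L[ℂ] Ell2 d) ((y : Ell2 d →L[ℂ] Ell2 d) (delta 0))⟫_ℂ =
      ⟪delta 0, (y : Ell2 d →L[ℂ] Ell2 d) ((x : Ell2 d →L[ℂ] Ell2 d) (delta 0))⟫_ℂ
    rw [inner_delta_mul, inner_delta_mul, ← (Equiv.neg (Fin d → ℤ)).tsum_eq]
    refine tsum_congr fun n => ?_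
    simp only [Equiv.neg_apply, neg_neg]
    rw [cocycle_neg_comm]
    ring
  nonneg x := by
    change 0 ≤ (⟪delta 0, ContinuousLinearMap.adjoint (x : Ell2 d →L[ℂ] Ell2 d)
      ((x : Ell2 d →L[ℂ] Ell2 d) (delta 0))⟫_ℂ).re
    rw [ContinuousLinearMap.adjoint_inner_right]
    exact inner_self_nonneg (𝕜 := ℂ)
  bounded x := by
    refine ⟨‖(x : Ell2 d →L[ℂ] Ell2 d)‖ ^ 2, fun y => ?_⟩
    have h : ∀ z : QTorus θ, (⟪delta 0, ((star z * z : QTorus θ) : Ell2 d →L[ℂ] Ell2 d)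
        (delta 0)⟫_ℂ).re = ‖(z : Ell2 d →L[ℂ] Ell2 d) (delta 0)‖ ^ 2 := by
      intro z
      change (⟪delta 0, ContinuousLinearMap.adjoint (z : Ell2 d →L[ℂ] Ell2 d)
        ((z : Ell2 d →L[ℂ] Ell2 d) (delta 0))⟫_ℂ).re = _
      rw [ContinuousLinearMap.adjoint_inner_right]
      exact inner_self_eq_norm_sq (𝕜 := ℂ) _
    refine (h (x * y)).le.trans (le_trans ?_ (mul_le_mul_of_nonneg_left (h y).ge (sq_nonneg _)))
    rw [← mul_pow]
    exact pow_le_pow_left₀ (norm_nonneg _)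
      ((x : Ell2 d →L[ℂ] Ell2 d).le_opNorm ((y : Ell2 d →L[ℂ] Ell2 d) (delta 0))) 2

/-- The Hilbert space `L²(𝕋_θ^d)`. -/
abbrev TorusL2 (θ : Matrix (Fin d) (Fin d) ℝ) : Type := (torusTrace θ).L2

/-- The Hilbert space `L²(𝕋_θ^d ⊗ (𝕋_θ^d)ᵒᵖ)`. -/
abbrev TorusKernelL2 (θ : Matrix (Fin d) (Fin d) ℝ) : Type := (torusTrace θ).KernelL2

/-! ### The mixed Sobolev space -/

/-- The Fourier coefficient `(τ ⊗ τ)((U^m ⊗ U^n)* k)` of a kernel. -/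
def kernelCoeff (θ : Matrix (Fin d) (Fin d) ℝ) (k : TorusKernelL2 θ) (m n : Fin d → ℤ) : ℂ :=
  ⟪((torusTrace θ).tensor (torusTrace θ).op).incl (U θ m ⊗ₜ[ℂ] MulOpposite.op (U θ n)), k⟫_ℂ

/-- The symbol `(1 + |m|²)^{α/2}` of the Bessel potential `J^α`, with `|m|` the Euclidean norm. -/
def besselSymbol (α : ℝ) (m : Fin d → ℤ) : ℝ := (1 + ∑ j, (m j : ℝ) ^ 2) ^ (α / 2)

/-- The Fourier coefficients of the distribution `(J^{α₁} ⊗ J^{α₂}) k`. -/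
def besselKernelCoeff (θ : Matrix (Fin d) (Fin d) ℝ) (α₁ α₂ : ℝ) (k : TorusKernelL2 θ)
    (m n : Fin d → ℤ) : ℂ :=
  ((besselSymbol α₁ m * besselSymbol α₂ n : ℝ) : ℂ) * kernelCoeff θ k m n

/-- `k ∈ H^{α₁,α₂}(𝕋_θ^d ⊗ (𝕋_θ^d)ᵒᵖ)`: the distribution `(J^{α₁} ⊗ J^{α₂}) k` is an element of
`L²`. -/
def MemMixedSobolev (θ : Matrix (Fin d) (Fin d) ℝ) (α₁ α₂ : ℝ) (k : TorusKernelL2 θ) : Prop :=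
  ∃ h : TorusKernelL2 θ, ∀ m n, kernelCoeff θ h m n = besselKernelCoeff θ α₁ α₂ k m n

end NCTorus

end

namespace NCTorus

/-! ### Finite rank approximation of Hilbert–Schmidt operators -/

section Approximation

variable {H : Type*} [NormedAddCommGroup H] [InnerProductSpace ℂ H]

/-! In the orthonormal basis `U^m` of `L²(𝕋_θ^d)` the matrix of `T_k` is, up to unimodular factors,
the array of Fourier coefficients of `k` at `(m, -n)`, because `(U^n)*` is a unimodular multiple of
`U^{-n}` (`norm_inner_integralOperator`). The Bessel weights are even, so Bessel's inequality for `h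
= (J^{α₁} ⊗ J^{α₂}) k` bounds `∑ (1+|m|²)^{α₁} (1+|n|²)^{α₂} |T_{mn}|²` by `‖h‖²`
(`sum_weighted_matrix_le`). Noncommutativity plays no further role.

What remains is a statement about weighted Hilbert–Schmidt matrices over `ℤ^d`
(`exists_approximation_of_weighted_matrix`). Write `α = α₁ + α₂` and let `F` be a cube of side about
`s`. Removing the rows and columns indexed by `F` costs rank at most `2|F|`. On what is left both
weights are large, so its squared Hilbert–Schmidt norm is `O(s^{-2α})`. Further approximation by
rank `|F| ~ s^d` divides the squared error by about `s^d` (`exists_rank_le_norm_sub_le`). Hence rank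
`n ~ s^d` gives an error `O(n^{-(α/d + 1/2)})`, and the `r`-th powers are summable as soon as `r
(α/d + 1/2) > 1`, that is, `r > 2d/(d + 2α)`.

The gain from rank comes from a greedy argument: if no operator of rank at most `n` is within `ε` of
`T`, one can choose `n + 1` orthonormal vectors with `‖T vᵢ‖ ≥ ε`, and the Hilbert–Schmidt bound
limits `(n + 1) ε²`. -/

theorem exists_orthonormal_of_forall_lt_norm_sub (T : H →L[ℂ] H) {n : ℕ} {ε : ℝ} (hε : 0 ≤ ε)
    (hT : ∀ R : H →L[ℂ] H, R.toLinearMap.rank ≤ (n : Cardinal) → ε < ‖T - R‖) (j : ℕ)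
    (hj : j ≤ n + 1) : ∃ v : Fin j → H, Orthonormal ℂ v ∧ ∀ i, ε ≤ ‖T (v i)‖ := by
  induction j with
  | zero => exact ⟨Fin.elim0, ⟨fun i => i.elim0, fun i => i.elim0⟩, fun i => i.elim0⟩
  | succ j ih =>
    obtain ⟨v, hv, hvT⟩ := ih (by omega)
    let V := Submodule.span ℂ (Set.range v)
    have : FiniteDimensional ℂ V := FiniteDimensional.span_of_finite ℂ (Set.finite_range v)
    let P := V.starProjection
    -- `P` projects onto the span of the `j ≤ n` vectors already chosen, so `T P` is an admissible
    -- competitor and `‖T (1 - P)‖ > ε`. A normalized vector of the form `(1 - P) x` then extends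
    -- the system.
    have hrank : (T ∘L P).toLinearMap.rank ≤ (n : Cardinal) := by
      refine (LinearMap.rank_comp_le_right P.toLinearMap T.toLinearMap).trans ?_
      have h1 : LinearMap.range P.toLinearMap ≤ V := by
        rintro _ ⟨x, rfl⟩
        exact Submodule.starProjection_apply_mem V x
      refine (Submodule.rank_mono h1).trans ?_
      refine (rank_span_le _).trans ?_
      have hcard := Cardinal.mk_range_le_lift (f := v)
      simp only [Cardinal.lift_uzero, Cardinal.mk_fin, Cardinal.lift_natCast] at hcard
      exact hcard.trans (by exact_mod_cast Nat.le_of_lt_succ hj)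
    have hlt := hT _ hrank
    have hx : ∃ x, ε * ‖x‖ < ‖(T - T ∘L P) x‖ := by
      by_contra! h
      exact hlt.not_ge (ContinuousLinearMap.opNorm_le_bound _ hε h)
    obtain ⟨x, hx⟩ := hx
    -- Replacing `x` by its component orthogonal to the chosen vectors keeps the image under `T (1 -
    -- P)` and does not increase the norm, so the lower bound survives normalization.
    set y := x - P x with hy
    have hyx : ‖y‖ ≤ ‖x‖ := by
      have := V.norm_sq_eq_add_norm_sq_starProjection x
      have h2 : Vᗮ.starProjection x = y := by
        rw [Submodule.starProjection_orthogonal]; rfl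
      rw [h2] at this
      nlinarith [norm_nonneg x, norm_nonneg y, sq_nonneg ‖V.starProjection x‖]
    have hTy : (T - T ∘L P) x = T y := by simp [hy]
    rw [hTy] at hx
    have hy0 : y ≠ 0 := by
      intro h
      rw [h, map_zero, norm_zero] at hx
      exact hx.not_ge (by positivity)
    have hny : 0 < ‖y‖ := norm_pos_iff.mpr hy0
    have hyo : ∀ i, ⟪v i, y⟫_ℂ = 0 := fun i =>
      (Submodule.mem_orthogonal _ _).mp (V.sub_starProjection_mem_orthogonal x) _
        (Submodule.subset_span ⟨i, rfl⟩)
    refine ⟨Fin.cons (((‖y‖⁻¹ : ℝ) : ℂ) • y) v, ?_, ?_⟩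
    · refine ⟨fun i => ?_, fun i i' hii => ?_⟩
      · refine Fin.cases ?_ (fun i => ?_) i
        · simp [norm_smul, hny.ne']
        · simpa using hv.1 i
      · induction i using Fin.cases with
        | zero =>
          induction i' using Fin.cases with
          | zero => exact absurd rfl hii
          | succ i' =>
            have : ⟪y, v i'⟫_ℂ = 0 := inner_eq_zero_symm.mp (hyo i')
            simp [inner_smul_left, this]
        | succ i =>
          induction i' using Fin.cases with
          | zero => simp [inner_smul_right, hyo]
          | succ i' =>
            simpa using hv.2 (fun h => hii (by rw [h]))
    · refine Fin.cases ?_ (fun i => ?_)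
      · simp only [Fin.cons_zero, map_smul, norm_smul, Complex.norm_real, norm_inv, norm_norm]
        rw [inv_mul_eq_div, le_div_iff₀ hny]
        exact (mul_le_mul_of_nonneg_left hyx hε).trans hx.le
      · simpa using hvT i

/-- If `∑ ‖T vᵢ‖² ≤ C` for all orthonormal systems, then `T` has approximations of rank `n` up to
every error `ε > √(C / (n + 1))`. -/
theorem exists_rank_le_norm_sub_le (T : H →L[ℂ] H) {C : ℝ}
    (hT : ∀ (j : ℕ) (v : Fin j → H), Orthonormal ℂ v → ∑ i, ‖T (v i)‖ ^ 2 ≤ C) (n : ℕ) {ε : ℝ}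
    (hε : 0 ≤ ε) (hC : C < (n + 1) * ε ^ 2) :
    ∃ R : H →L[ℂ] H, R.toLinearMap.rank ≤ (n : Cardinal) ∧ ‖T - R‖ ≤ ε := by
  by_contra! h
  obtain ⟨v, hv, hvT⟩ := exists_orthonormal_of_forall_lt_norm_sub T hε h (n + 1) le_rfl
  refine hC.not_ge (le_trans ?_ (hT _ v hv))
  calc ((n : ℝ) + 1) * ε ^ 2 = ∑ _i : Fin (n + 1), ε ^ 2 := by simp
    _ ≤ _ := Finset.sum_le_sum fun i _ => pow_le_pow_left₀ hε (hvT i) 2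

/-! ### Matrix entries in a Hilbert basis and truncation -/

variable {ι : Type*}

theorem hasSum_norm_inner_sq (e : HilbertBasis ι ℂ H) (x : H) :
    HasSum (fun m => ‖⟪e m, x⟫_ℂ‖ ^ 2) (‖x‖ ^ 2) := by
  have h := (e.hasSum_inner_mul_inner x x).mapL Complex.reCLM
  have h2 : Complex.reCLM ⟪x, x⟫_ℂ = ‖x‖ ^ 2 := inner_self_eq_norm_sq (𝕜 := ℂ) x
  rw [h2] at h
  convert h using 2 with m
  change _ = (⟪x, e m⟫_ℂ * ⟪e m, x⟫_ℂ).re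
  rw [← inner_conj_symm, RCLike.norm_conj, RCLike.mul_conj]
  norm_cast

/-- Expand each `‖T vᵢ‖²` in the basis, move `T` onto `e m` as its adjoint, and apply Bessel's
inequality to `T* e_m` and the system `v`: the sum over `i` is at most `‖T* e_m‖²`, whose own
expansion is the `m`-th row of the matrix. Bounding finite sums throughout avoids any summability
hypothesis on the double array. -/
theorem sum_norm_sq_le_of_orthonormal [CompleteSpace H]
    (e : HilbertBasis ι ℂ H) (T : H →L[ℂ] H) {C : ℝ}
    (hT : ∀ G : Finset (ι × ι), ∑ p ∈ G, ‖⟪e p.1, T (e p.2)⟫_ℂ‖ ^ 2 ≤ C) {j : ℕ}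
    (v : Fin j → H) (hv : Orthonormal ℂ v) : ∑ i, ‖T (v i)‖ ^ 2 ≤ C := by
  have h1 : HasSum (fun m => ∑ i, ‖⟪e m, T (v i)⟫_ℂ‖ ^ 2) (∑ i, ‖T (v i)‖ ^ 2) :=
    hasSum_sum fun i _ => hasSum_norm_inner_sq e _
  refine hasSum_le_of_sum_le h1 fun F => ?_
  have h2 : HasSum (fun n => ∑ m ∈ F, ‖⟪e m, T (e n)⟫_ℂ‖ ^ 2)
      (∑ m ∈ F, ‖ContinuousLinearMap.adjoint T (e m)‖ ^ 2) := by
    refine hasSum_sum fun m _ => ?_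
    convert hasSum_norm_inner_sq e (ContinuousLinearMap.adjoint T (e m)) using 3 with n
    rw [ContinuousLinearMap.adjoint_inner_right, norm_inner_symm]
  calc ∑ m ∈ F, ∑ i, ‖⟪e m, T (v i)⟫_ℂ‖ ^ 2
      ≤ ∑ m ∈ F, ‖ContinuousLinearMap.adjoint T (e m)‖ ^ 2 := by
        refine Finset.sum_le_sum fun m _ => ?_
        have := hv.sum_inner_products_le (x := ContinuousLinearMap.adjoint T (e m))
          (s := Finset.univ)
        refine (Finset.sum_le_sum fun i _ => le_of_eq ?_).trans this
        rw [← ContinuousLinearMap.adjoint_inner_left, norm_inner_symm]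
    _ ≤ C := by
        refine hasSum_le_of_sum_le h2 fun G => ?_
        rw [Finset.sum_comm, ← Finset.sum_product']
        exact hT (F ×ˢ G)

/-- The orthogonal projection onto the span of the basis vectors with index in `F`. -/
noncomputable def basisProj (e : HilbertBasis ι ℂ H) (F : Finset ι) : H →L[ℂ] H :=
  ∑ m ∈ F, (innerSL ℂ (e m)).smulRight (e m)

theorem basisProj_apply (e : HilbertBasis ι ℂ H) (F : Finset ι) (x : H) :
    basisProj e F x = ∑ m ∈ F, ⟪e m, x⟫_ℂ • e m := by
  simp [basisProj]

theorem inner_basisProj [DecidableEq ι] (e : HilbertBasis ι ℂ H) (F : Finset ι) (m : ι) (x : H) :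
    ⟪e m, basisProj e F x⟫_ℂ = if m ∈ F then ⟪e m, x⟫_ℂ else 0 := by
  simp [basisProj_apply, orthonormal_iff_ite.mp e.orthonormal]

theorem basisProj_self [DecidableEq ι] (e : HilbertBasis ι ℂ H) (F : Finset ι) (m : ι) :
    basisProj e F (e m) = if m ∈ F then e m else 0 := by
  simp [basisProj_apply, orthonormal_iff_ite.mp e.orthonormal]

theorem rank_basisProj_le (e : HilbertBasis ι ℂ H) (F : Finset ι) :
    (basisProj e F).toLinearMap.rank ≤ (F.card : Cardinal) := by
  classical
  have h1 : LinearMap.range (basisProj e F).toLinearMap ≤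
      Submodule.span ℂ ((F.image e : Finset H) : Set H) := by
    rintro _ ⟨x, rfl⟩
    change basisProj e F x ∈ _
    rw [basisProj_apply]
    exact Submodule.sum_mem _ fun m hm => Submodule.smul_mem _ _
      (Submodule.subset_span (by simpa using ⟨m, hm, rfl⟩))
  refine (Submodule.rank_mono h1).trans ((rank_span_finset_le _).trans ?_)
  exact_mod_cast Finset.card_image_le

/-- With `P` the projection for `F`, the identity `T = P T + (1 - P) T P + (1 - P) T (1 - P)` splits
off two terms of rank at most `|F|` each. The last term has exactly the matrix entries with both
indices outside `F`, so only these enter the Hilbert–Schmidt bound. -/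
theorem exists_rank_le_norm_sub_le_of_matrix [CompleteSpace H]
    (e : HilbertBasis ι ℂ H) (T : H →L[ℂ] H)
    (F : Finset ι) {C : ℝ}
    (hT : ∀ G : Finset (ι × ι), (∀ p ∈ G, p.1 ∉ F ∧ p.2 ∉ F) →
      ∑ p ∈ G, ‖⟪e p.1, T (e p.2)⟫_ℂ‖ ^ 2 ≤ C) (n : ℕ) {ε : ℝ}
    (hε : 0 ≤ ε) (hC : C < (n + 1) * ε ^ 2) :
    ∃ R : H →L[ℂ] H, R.toLinearMap.rank ≤ ((F.card + F.card + n : ℕ) : Cardinal) ∧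
      ‖T - R‖ ≤ ε := by
  classical
  set P := basisProj e F with hP
  set S := (1 - P) ∘L T ∘L (1 - P) with hS
  have hentry : ∀ p : ι × ι, ‖⟪e p.1, S (e p.2)⟫_ℂ‖ ^ 2 =
      if p.1 ∉ F ∧ p.2 ∉ F then ‖⟪e p.1, T (e p.2)⟫_ℂ‖ ^ 2 else 0 := by
    rintro ⟨m, n⟩
    have h1 : (1 - P) (e n) = if n ∈ F then 0 else e n := by
      simp only [sub_apply, one_apply_eq_self, hP, basisProj_self]
      split_ifs <;> simp
    have h2 : ∀ y, ⟪e m, (1 - P) y⟫_ℂ = if m ∈ F then 0 else ⟪e m, y⟫_ℂ := by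
      intro y
      simp only [sub_apply, one_apply_eq_self, hP,
        inner_sub_right, inner_basisProj]
      split_ifs <;> simp
    simp only [hS, ContinuousLinearMap.comp_apply, h1, h2]
    by_cases hm : m ∈ F <;> by_cases hn : n ∈ F <;> simp [hm, hn]
  have hSC : ∀ G : Finset (ι × ι), ∑ p ∈ G, ‖⟪e p.1, S (e p.2)⟫_ℂ‖ ^ 2 ≤ C := by
    intro G
    rw [Finset.sum_congr rfl fun p _ => hentry p, ← Finset.sum_filter]
    exact hT _ fun p hp => (Finset.mem_filter.mp hp).2
  obtain ⟨R, hR, hSR⟩ := exists_rank_le_norm_sub_le S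
    (fun j v hv => sum_norm_sq_le_of_orthonormal e S hSC v hv) n hε hC
  refine ⟨P ∘L T + (1 - P) ∘L T ∘L P + R, ?_, ?_⟩
  · have hPF := rank_basisProj_le e F
    have h1 := (LinearMap.rank_comp_le_left T.toLinearMap P.toLinearMap).trans hPF
    have h2 := (LinearMap.rank_comp_le_right P.toLinearMap
      ((1 - P) ∘L T).toLinearMap).trans hPF
    push_cast
    exact (LinearMap.rank_add_le _ _).trans (add_le_add
      ((LinearMap.rank_add_le _ _).trans (add_le_add h1 h2)) hR)
  · convert hSR using 2
    ext x
    simp only [hS, sub_apply, add_apply, one_apply_eq_self, ContinuousLinearMap.comp_apply, map_sub]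
    abel

/-! ### Singular values and Schatten membership from approximation rates -/

theorem isCompactOperator_of_rank_le (R : H →L[ℂ] H) {n : ℕ}
    (hR : R.toLinearMap.rank ≤ (n : Cardinal)) : IsCompactOperator R := by
  have hfin : FiniteDimensional ℂ (LinearMap.range R.toLinearMap) :=
    Module.rank_lt_aleph0_iff.mp (hR.trans_lt (Cardinal.natCast_lt_aleph0))
  have hproper := FiniteDimensional.proper ℂ (LinearMap.range R.toLinearMap)
  have h : IsCompactOperator (R.codRestrict (LinearMap.range R.toLinearMap) fun x => ⟨x, rfl⟩) :=
    (isCompactOperator_id (E := LinearMap.range R.toLinearMap)).comp_clm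
      (R.codRestrict (LinearMap.range R.toLinearMap) fun x => ⟨x, rfl⟩)
  exact h.clm_comp (LinearMap.range R.toLinearMap).subtypeL

theorem singularValue_nonneg (T : H →L[ℂ] H) (n : ℕ) : 0 ≤ singularValue T n := by
  refine Real.sInf_nonneg ?_
  rintro _ ⟨R, -, rfl⟩
  exact norm_nonneg _

theorem singularValue_le (T R : H →L[ℂ] H) {n : ℕ} (hR : R.toLinearMap.rank ≤ (n : Cardinal)) :
    singularValue T n ≤ ‖T - R‖ := by
  refine csInf_le ⟨0, ?_⟩ ⟨R, hR, rfl⟩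
  rintro _ ⟨R, -, rfl⟩
  exact norm_nonneg _

/-- The approximants have finite rank and converge in norm, which gives compactness. They also
dominate the singular values by `K (n + 1)^{-p}`, whose `r`-th powers form a convergent series when
`p r > 1`. -/
theorem isSchatten_of_approximation [CompleteSpace H]
    (T : H →L[ℂ] H) {K p r : ℝ} (hp : 0 < p) (hr : 0 < r)
    (hpr : 1 < p * r)
    (hT : ∀ n : ℕ, ∃ R : H →L[ℂ] H, R.toLinearMap.rank ≤ (n : Cardinal) ∧
      ‖T - R‖ ≤ K * ((n : ℝ) + 1) ^ (-p)) : IsSchatten r T := by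
  choose R hR hTR using hT
  constructor
  · have hlim : Filter.Tendsto (fun n : ℕ => K * ((n : ℝ) + 1) ^ (-p)) Filter.atTop (nhds 0) := by
      have h := ((tendsto_rpow_neg_atTop hp).comp
        (Filter.tendsto_atTop_add_const_right _ 1 tendsto_natCast_atTop_atTop)).const_mul K
      simpa using h
    refine isCompactOperator_of_tendsto (F := R) (l := Filter.atTop) ?_
      (Filter.Eventually.of_forall fun n => isCompactOperator_of_rank_le (R n) (hR n))
    rw [tendsto_iff_norm_sub_tendsto_zero]
    refine squeeze_zero (fun _ => norm_nonneg _) (fun n => ?_) hlim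
    rw [norm_sub_rev]
    exact hTR n
  · have hK : 0 ≤ K := by simpa using (norm_nonneg _).trans (hTR 0)
    have hsum : Summable fun n : ℕ => K ^ r * ((n : ℝ) + 1) ^ (-(p * r)) := by
      refine Summable.mul_left _ ?_
      have h := (summable_nat_add_iff 1).mpr
        (Real.summable_nat_rpow.mpr (by linarith : -(p * r) < -1))
      simpa using h
    refine hsum.of_nonneg_of_le (fun n => Real.rpow_nonneg (singularValue_nonneg T n) r) fun n => ?_
    have hn : (0 : ℝ) ≤ (n : ℝ) + 1 := by positivity
    calc singularValue T n ^ r ≤ (K * ((n : ℝ) + 1) ^ (-p)) ^ r :=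
          Real.rpow_le_rpow (singularValue_nonneg T n)
            ((singularValue_le T (R n) (hR n)).trans (hTR n)) hr.le
      _ = _ := by
          rw [Real.mul_rpow hK (Real.rpow_nonneg hn _), ← Real.rpow_mul hn, neg_mul]

/-! ### Weights outside a lattice cube and the approximation rate -/

theorem half_sq_le_one_add_sum_sq {d q : ℕ} {m : Fin d → ℤ}
    (hm : m ∉ Fintype.piFinset fun _ : Fin d => Finset.Ico (-(q : ℤ)) q) :
    ((q : ℝ) + 1) ^ 2 / 2 ≤ 1 + ∑ j, (m j : ℝ) ^ 2 := by
  simp only [Fintype.mem_piFinset, Finset.mem_Ico, not_forall] at hm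
  obtain ⟨j, hj⟩ := hm
  have h1 : (q : ℝ) ≤ |(m j : ℝ)| := by
    have : (q : ℤ) ≤ |m j| := by
      rw [le_abs]
      omega
    exact_mod_cast this
  have h2 : (q : ℝ) ^ 2 ≤ (m j : ℝ) ^ 2 := by
    rw [← sq_abs (m j : ℝ)]
    exact pow_le_pow_left₀ (by positivity) h1 2
  have h3 : (m j : ℝ) ^ 2 ≤ ∑ j, (m j : ℝ) ^ 2 :=
    Finset.single_le_sum (f := fun j => (m j : ℝ) ^ 2) (fun _ _ => sq_nonneg _) (Finset.mem_univ j)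
  -- `1 + q² ≥ (q + 1)²/2` is equivalent to `(q - 1)² ≥ 0`.
  nlinarith [sq_nonneg ((q : ℝ) - 1)]

theorem exists_approximation_of_weighted_matrix [CompleteSpace H] {d : ℕ} (hd : d ≠ 0)
    (e : HilbertBasis (Fin d → ℤ) ℂ H) (T : H →L[ℂ] H) {α₁ α₂ C : ℝ} (hα₁ : 0 ≤ α₁) (hα₂ : 0 ≤ α₂)
    (hT : ∀ G : Finset ((Fin d → ℤ) × (Fin d → ℤ)),
      ∑ p ∈ G, (1 + ∑ j, (p.1 j : ℝ) ^ 2) ^ α₁ * (1 + ∑ j, (p.2 j : ℝ) ^ 2) ^ α₂ *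
        ‖⟪e p.1, T (e p.2)⟫_ℂ‖ ^ 2 ≤ C) :
    ∃ K : ℝ, ∀ n : ℕ, ∃ R : H →L[ℂ] H, R.toLinearMap.rank ≤ (n : Cardinal) ∧
      ‖T - R‖ ≤ K * ((n : ℝ) + 1) ^ (-((α₁ + α₂) / d + 1 / 2)) := by
  have hC : 0 ≤ C := by simpa using hT ∅
  set α := α₁ + α₂ with hα
  set p := α / d + 1 / 2 with hp
  have hd' : (0 : ℝ) < d := by exact_mod_cast Nat.pos_of_ne_zero hd
  have hα0 : 0 ≤ α := add_nonneg hα₁ hα₂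
  have hp0 : 0 < p := by positivity
  -- `C + 1` in place of `C` makes the later comparison strict even if `C = 0`; the factor `2 ^ α`
  -- compensates the `1/2` in the lower bound for the weights.
  set M := Real.sqrt ((C + 1) * 2 ^ α) with hM
  set B : ℝ := 3 * 2 ^ d with hB
  have hB0 : 0 < B := by positivity
  refine ⟨M * B ^ p, fun n => ?_⟩
  have hex : ∃ q : ℕ, n < 3 * (2 * (q + 1)) ^ d := by
    refine ⟨n, ?_⟩
    have : 2 * (n + 1) ≤ (2 * (n + 1)) ^ d := Nat.le_self_pow hd _
    omega
  -- `q` is the largest integer for which a cube of `(2q)^d` points can be afforded three times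
  -- within rank `n`: for the rows, for the columns, and for the remainder. Its maximality gives `n
  -- + 1 ≤ B (q + 1)^d`.
  obtain ⟨q, hq1, hq2⟩ : ∃ q : ℕ, 3 * (2 * q) ^ d ≤ n ∧ n < 3 * (2 * (q + 1)) ^ d := by
    classical
    refine ⟨Nat.find hex, ?_, Nat.find_spec hex⟩
    rcases h : Nat.find hex with _ | q
    · simp [hd]
    · exact not_lt.mp (Nat.find_min hex (h ▸ Nat.lt_succ_self q))
  set s : ℝ := (q : ℝ) + 1 with hs
  have hs0 : 0 < s := by positivity
  set F := Fintype.piFinset fun _ : Fin d => Finset.Ico (-(q : ℤ)) q with hF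
  have hcard : F.card = (2 * q) ^ d := by
    rw [hF, Fintype.card_piFinset_const, Int.card_Ico]
    congr 1
    omega
  set a := s ^ 2 / 2 with ha
  have ha0 : 0 < a := by positivity
  have hent : ∀ G : Finset ((Fin d → ℤ) × (Fin d → ℤ)), (∀ p ∈ G, p.1 ∉ F ∧ p.2 ∉ F) →
      ∑ p ∈ G, ‖⟪e p.1, T (e p.2)⟫_ℂ‖ ^ 2 ≤ C * a ^ (-α) := by
    intro G hG
    rw [Real.rpow_neg ha0.le, ← div_eq_mul_inv, le_div_iff₀ (by positivity), mul_comm,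
      Finset.mul_sum]
    refine (Finset.sum_le_sum fun p hp => ?_).trans (hT G)
    refine mul_le_mul_of_nonneg_right ?_ (by positivity)
    rw [hα, Real.rpow_add ha0]
    have h1 := half_sq_le_one_add_sum_sq (hG p hp).1
    have h2 := half_sq_le_one_add_sum_sq (hG p hp).2
    exact mul_le_mul (Real.rpow_le_rpow ha0.le h1 hα₁) (Real.rpow_le_rpow ha0.le h2 hα₂)
      (by positivity) (by positivity)
  set ε := M * (s ^ d) ^ (-p) with hε
  have hsd : 0 < s ^ d := by positivity
  have hε0 : 0 ≤ ε := by positivity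
  -- For `q ≥ 1` this follows from `q + 1 ≤ 2q`. For `q = 0` the cube is empty and the summand `1`
  -- is needed.
  have hqd : s ^ d ≤ (((2 * q) ^ d : ℕ) : ℝ) + 1 := by
    rcases Nat.eq_zero_or_pos q with h | h
    · simp [hs, h, hd]
    · have h1 : (1 : ℝ) ≤ q := by exact_mod_cast h
      have : s ^ d ≤ (2 * q) ^ d := pow_le_pow_left₀ hs0.le (by linarith) d
      push_cast
      linarith
  have haα : a ^ (-α) = 2 ^ α * (s ^ d) ^ (-(2 * α / d)) := by
    rw [ha, Real.div_rpow (by positivity) (by norm_num), ← Real.rpow_natCast s d,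
      ← Real.rpow_mul hs0.le, ← Real.rpow_natCast s 2, ← Real.rpow_mul hs0.le,
      Real.rpow_neg two_pos.le, div_inv_eq_mul, mul_comm]
    congr 2
    field_simp
    push_cast
    ring
  have hεsq : ε ^ 2 = (C + 1) * 2 ^ α * ((s ^ d) ^ (-(2 * α / d)) * (s ^ d)⁻¹) := by
    rw [hε, mul_pow, hM, Real.sq_sqrt (by positivity), ← Real.rpow_natCast ((s ^ d) ^ (-p)) 2,
      ← Real.rpow_mul hsd.le, ← Real.rpow_neg_one (s ^ d), ← Real.rpow_add hsd]
    congr 2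
    rw [hp]
    push_cast
    ring
  -- `ε` is chosen so that `s^d ε² = (C + 1) a^{-α}`. Here `C a^{-α}` bounds the remainder, which is
  -- approximated with rank `(2q)^d = |F|`.
  have hlt : C * a ^ (-α) < ((((2 * q) ^ d : ℕ) : ℝ) + 1) * ε ^ 2 := by
    calc C * a ^ (-α) < (C + 1) * a ^ (-α) :=
          mul_lt_mul_of_pos_right (lt_add_one C) (by positivity)
      _ = s ^ d * ε ^ 2 := by
          rw [hεsq, haα]
          field_simp
      _ ≤ _ := mul_le_mul_of_nonneg_right hqd (sq_nonneg _)
  obtain ⟨R, hR, hTR⟩ := exists_rank_le_norm_sub_le_of_matrix e T F hent _ hε0 hlt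
  refine ⟨R, hR.trans ?_, hTR.trans ?_⟩
  · rw [Nat.cast_le, hcard]
    omega
  · rw [hε, mul_assoc]
    refine mul_le_mul_of_nonneg_left ?_ (Real.sqrt_nonneg _)
    have hn : ((n : ℝ) + 1) / B ≤ s ^ d := by
      rw [div_le_iff₀ hB0, hB, hs]
      have : ((n + 1 : ℕ) : ℝ) ≤ ((3 * (2 * (q + 1)) ^ d : ℕ) : ℝ) := by exact_mod_cast hq2
      push_cast [mul_pow] at this
      linarith
    have hn0 : (0 : ℝ) < (n : ℝ) + 1 := by positivity
    calc (s ^ d) ^ (-p) ≤ (((n : ℝ) + 1) / B) ^ (-p) :=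
          Real.rpow_le_rpow_of_nonpos (by positivity) hn (by linarith)
      _ = B ^ p * ((n : ℝ) + 1) ^ (-p) := by
          rw [Real.div_rpow hn0.le hB0.le, Real.rpow_neg hB0.le, div_inv_eq_mul, mul_comm]

end Approximation

end NCTorus

namespace NCTorus

/-! ### Integral operators on tracial algebras -/

section Kernel

variable {A : Type*} [Ring A] [StarRing A] [Algebra ℂ A] [StarModule ℂ A] (τ : TracialState A)

/-- On elementary tensors this is the trace property in the second leg; both sides are continuous in
`k` and the algebraic tensors are dense. -/
theorem TracialState.applyRight_eq_applyLeft (k : τ.KernelL2) (x : A) :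
    τ.applyRight k x = τ.applyLeft k x := by
  have h : TracialState.slice τ τ.op ∘L (τ.tensor τ.op).rmul (TracialState.oneTensor x) =
      TracialState.slice τ τ.op ∘L (τ.tensor τ.op).lmul (TracialState.oneTensor x) := by
    refine TracialState.ext_L2 _ fun y => ?_
    simp only [ContinuousLinearMap.comp_apply, TracialState.rmul_incl, TracialState.lmul_incl,
      TracialState.slice_incl]
    congr 1
    induction y using TensorProduct.induction_on with
    | zero => simp
    | add y₁ y₂ h₁ h₂ => rw [add_mul, mul_add, map_add, map_add, h₁, h₂]
    | tmul a b =>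
      rw [TracialState.oneTensor_apply, Algebra.TensorProduct.tmul_mul_tmul,
        Algebra.TensorProduct.tmul_mul_tmul, TracialState.sliceLin_tmul,
        TracialState.sliceLin_tmul, mul_one, one_mul, τ.op.trace]
  exact DFunLike.congr_fun h k

/-- For algebraic `k`, cyclicity gives `(τ ⊗ τ)((a* ⊗ 1) k (1 ⊗ x)) = (τ ⊗ τ)((a* ⊗ x) k)`, and `a*
⊗ x` is the adjoint of `a ⊗ x*`. Density gives the rest. This identifies matrix entries of `T_k`
with Fourier coefficients of `k`. -/
theorem TracialState.inner_applyRight (k : τ.KernelL2) (a x : A) :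
    ⟪τ.incl a, τ.applyRight k x⟫_ℂ =
      ⟪(τ.tensor τ.op).incl (a ⊗ₜ[ℂ] MulOpposite.op (star x)), k⟫_ℂ := by
  have h : innerSL ℂ (τ.incl a) ∘L TracialState.slice τ τ.op ∘L
        (τ.tensor τ.op).rmul (TracialState.oneTensor x) =
      innerSL ℂ ((τ.tensor τ.op).incl (a ⊗ₜ[ℂ] MulOpposite.op (star x))) := by
    refine TracialState.ext_L2 _ fun y => ?_
    simp only [ContinuousLinearMap.comp_apply, TracialState.rmul_incl, TracialState.slice_incl,
      innerSL_apply_apply, TracialState.inner_incl]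
    rw [TracialState.inner_sliceLin, ← mul_assoc, TracialState.trace, ← mul_assoc]
    simp [TracialState.oneTensor_apply]
  exact DFunLike.congr_fun h k

theorem TracialState.inner_applyRight_of_star_eq (k : τ.KernelL2) (a : A) {x y : A} {c : ℂ}
    (h : star x = c • y) : ⟪τ.incl a, τ.applyRight k x⟫_ℂ =
      conj c * ⟪(τ.tensor τ.op).incl (a ⊗ₜ[ℂ] MulOpposite.op y), k⟫_ℂ := by
  rw [τ.inner_applyRight, h, MulOpposite.op_smul, TensorProduct.tmul_smul, map_smul,
    inner_smul_left]

end Kernel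

/-! ### The Fourier basis of the quantum torus -/

section Torus

variable {d : ℕ} (θ : Matrix (Fin d) (Fin d) ℝ)

theorem lambda_delta_zero (m : Fin d → ℤ) : lambda θ m (delta 0) = delta m := by
  ext n
  rw [lambda_apply, delta_apply, delta_apply]
  by_cases h : n = m
  · simp [h, cocycle_zero_right]
  · simp [h, sub_eq_zero]

theorem torusTrace_star_mul (x y : QTorus θ) :
    (torusTrace θ).toLin (star x * y) =
      ⟪(x : Ell2 d →L[ℂ] Ell2 d) (delta 0), (y : Ell2 d →L[ℂ] Ell2 d) (delta 0)⟫_ℂ :=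
  ContinuousLinearMap.adjoint_inner_right (x : Ell2 d →L[ℂ] Ell2 d) (delta 0)
    ((y : Ell2 d →L[ℂ] Ell2 d) (delta 0))

theorem torusTrace_star_U_mul (m : Fin d → ℤ) (x : QTorus θ) :
    (torusTrace θ).toLin (star (U θ m) * x) = (x : Ell2 d →L[ℂ] Ell2 d) (delta 0) m := by
  rw [torusTrace_star_mul]
  change ⟪lambda θ m (delta 0), _⟫_ℂ = _
  rw [lambda_delta_zero, inner_delta_left]

theorem torusTrace_star_U_mul_U (m n : Fin d → ℤ) :
    (torusTrace θ).toLin (star (U θ m) * U θ n) = if m = n then 1 else 0 := by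
  rw [torusTrace_star_U_mul]
  change lambda θ n (delta 0) m = _
  rw [lambda_delta_zero, delta_apply]

theorem orthonormal_incl_U : Orthonormal ℂ fun m => (torusTrace θ).incl (U θ m) := by
  classical
  rw [orthonormal_iff_ite]
  intro m n
  rw [TracialState.inner_incl, torusTrace_star_U_mul_U]

/-- The linear map `x ↦ x δ_0`. -/
noncomputable def applyDeltaZero : QTorus θ →ₗ[ℂ] Ell2 d where
  toFun x := (x : Ell2 d →L[ℂ] Ell2 d) (delta 0)
  map_add' _ _ := rfl
  map_smul' _ _ := rfl

theorem applyDeltaZero_U (m : Fin d → ℤ) : applyDeltaZero θ (U θ m) = delta m :=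
  lambda_delta_zero θ m

/-- Evaluation at `δ_0` is isometric for the 2-norm, so questions about Fourier series of elements
of the von Neumann algebra can be settled in `ℓ²(ℤᵈ)`. -/
theorem norm_incl_torus (x : QTorus θ) : ‖(torusTrace θ).incl x‖ = ‖applyDeltaZero θ x‖ := by
  rw [← sq_eq_sq₀ (norm_nonneg _) (norm_nonneg _), TracialState.norm_incl,
    TracialState.norm_toPre_sq, torusTrace_star_mul]
  exact inner_self_eq_norm_sq (𝕜 := ℂ) (applyDeltaZero θ x)

theorem hasSum_delta (f : Ell2 d) : HasSum (fun m => f m • delta m) f := by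
  have h := lp.hasSum_single (by norm_num) f
  convert h using 2 with m
  rw [delta, ← lp.single_smul, smul_eq_mul, mul_one]

/-- The Fourier series of an element of the quantum torus converges in `L²`. -/
theorem hasSum_incl_U (x : QTorus θ) :
    HasSum (fun m => applyDeltaZero θ x m • (torusTrace θ).incl (U θ m))
      ((torusTrace θ).incl x) := by
  have h := hasSum_delta (applyDeltaZero θ x)
  rw [HasSum, SummationFilter.unconditional_filter, tendsto_iff_norm_sub_tendsto_zero] at h ⊢
  -- The error of a partial Fourier sum has the same norm as its image under the isometry, which is
  -- the error of the corresponding partial expansion of `x δ_0`.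
  refine h.congr fun F => ?_
  simp only [← map_smul, ← map_sum, ← map_sub]
  rw [norm_incl_torus, map_sub, map_sum]
  simp only [map_smul, applyDeltaZero_U]

theorem mem_closure_span_incl_U (x : QTorus θ) : (torusTrace θ).incl x ∈
    (Submodule.span ℂ (Set.range fun m => (torusTrace θ).incl (U θ m))).topologicalClosure :=
  mem_closure_of_tendsto (f := fun F : Finset (Fin d → ℤ) =>
    ∑ m ∈ F, applyDeltaZero θ x m • (torusTrace θ).incl (U θ m)) (hasSum_incl_U θ x)
    (Filter.Eventually.of_forall fun _ =>
    Submodule.sum_mem _ fun m _ => Submodule.smul_mem _ _ (Submodule.subset_span ⟨m, rfl⟩))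

/-- The Hilbert basis `(U^m)` of `L²(𝕋_θ^d)`. -/
noncomputable def fourierBasis : HilbertBasis (Fin d → ℤ) ℂ (TorusL2 θ) :=
  HilbertBasis.mk (orthonormal_incl_U θ) (by
    rintro x -
    induction x using UniformSpace.Completion.induction_on with
    | hp =>
      exact (Submodule.span ℂ (Set.range fun m =>
        (torusTrace θ).incl (U θ m))).isClosed_topologicalClosure
    | ih a => exact mem_closure_span_incl_U θ a)

theorem fourierBasis_apply (m : Fin d → ℤ) :
    fourierBasis θ m = (torusTrace θ).incl (U θ m) := by
  rw [fourierBasis, HilbertBasis.coe_mk]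

/-- Orthonormality alone suffices on the kernel side: only Bessel's inequality is used there, not
completeness. -/
theorem orthonormal_incl_U_tmul_U :
    Orthonormal ℂ fun p : (Fin d → ℤ) × (Fin d → ℤ) =>
      ((torusTrace θ).tensor (torusTrace θ).op).incl
        (U θ p.1 ⊗ₜ[ℂ] MulOpposite.op (U θ p.2)) := by
  classical
  rw [orthonormal_iff_ite]
  rintro ⟨m, n⟩ ⟨m', n'⟩
  rw [TracialState.inner_incl]
  change TracialState.tensorLin _ _ _ = _
  rw [TensorProduct.star_tmul, Algebra.TensorProduct.tmul_mul_tmul, TracialState.tensorLin_tmul,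
    torusTrace_star_U_mul_U, ← MulOpposite.op_star, ← MulOpposite.op_mul, TracialState.op_apply,
    TracialState.trace, torusTrace_star_U_mul_U]
  by_cases hm : m = m' <;> by_cases hn : n = n' <;> simp [hm, hn]

/-! ### The matrix of the integral operator and its Bessel weights -/

theorem star_U (m : Fin d → ℤ) : star (U θ m) = (cocycle θ m (-m))⁻¹ • U θ (-m) :=
  Subtype.ext (star_lambda θ m)

theorem norm_inner_integralOperator (k : TorusKernelL2 θ) (m n : Fin d → ℤ) :
    ‖⟪fourierBasis θ m, (torusTrace θ).integralOperator k (fourierBasis θ n)⟫_ℂ‖ =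
      ‖kernelCoeff θ k m (-n)‖ := by
  have h : ⟪fourierBasis θ m, (torusTrace θ).integralOperator k (fourierBasis θ n)⟫_ℂ =
      conj (cocycle θ n (-n))⁻¹ * kernelCoeff θ k m (-n) := by
    rw [fourierBasis_apply, fourierBasis_apply, TracialState.integralOperator_incl]
    exact TracialState.inner_applyRight_of_star_eq _ _ _ (star_U θ n)
  rw [h, norm_mul, Complex.norm_conj, norm_inv, norm_cocycle, inv_one, one_mul]

theorem besselSymbol_sq (α : ℝ) (m : Fin d → ℤ) :
    besselSymbol α m ^ 2 = (1 + ∑ j, (m j : ℝ) ^ 2) ^ α := by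
  have h : 0 ≤ 1 + ∑ j, (m j : ℝ) ^ 2 := by positivity
  rw [besselSymbol, ← Real.rpow_natCast, ← Real.rpow_mul h]
  congr 1
  push_cast
  ring

theorem sum_weighted_matrix_le {α₁ α₂ : ℝ} {k h : TorusKernelL2 θ}
    (hh : ∀ m n, kernelCoeff θ h m n = besselKernelCoeff θ α₁ α₂ k m n)
    (G : Finset ((Fin d → ℤ) × (Fin d → ℤ))) :
    ∑ p ∈ G, (1 + ∑ j, (p.1 j : ℝ) ^ 2) ^ α₁ * (1 + ∑ j, (p.2 j : ℝ) ^ 2) ^ α₂ *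
      ‖⟪fourierBasis θ p.1, (torusTrace θ).integralOperator k (fourierBasis θ p.2)⟫_ℂ‖ ^ 2 ≤
        ‖h‖ ^ 2 := by
  -- The column index `n` corresponds to the Fourier mode `-n` in the second leg, so the family is
  -- reindexed by this injection.
  have horth := (orthonormal_incl_U_tmul_U θ).comp
    (fun p : (Fin d → ℤ) × (Fin d → ℤ) => (p.1, -p.2)) (fun p q hpq => by
      simpa [Prod.ext_iff] using hpq)
  refine (Finset.sum_le_sum fun p _ => le_of_eq ?_).trans
    (horth.sum_inner_products_le (x := h) (s := G))
  rw [norm_inner_integralOperator]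
  change _ = ‖kernelCoeff θ h p.1 (-p.2)‖ ^ 2
  rw [hh, besselKernelCoeff, norm_mul, Complex.norm_real, mul_pow, Real.norm_eq_abs, sq_abs,
    mul_pow, besselSymbol_sq, besselSymbol_sq]
  -- The weight is even in the second index.
  simp

end Torus

end NCTorus

theorem mainTheorem2 (d : ℕ) (hd : 2 ≤ d) (θ : Matrix (Fin d) (Fin d) ℝ)
    (hθ : θ.transpose = -θ) (α₁ α₂ : ℝ) (hα₁ : 0 ≤ α₁) (hα₂ : 0 ≤ α₂)
    (k : NCTorus.TorusKernelL2 θ) (hk : NCTorus.MemMixedSobolev θ α₁ α₂ k) :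
    (∀ x : NCTorus.QTorus θ,
      (NCTorus.torusTrace θ).integralOperator k ((NCTorus.torusTrace θ).incl x) =
          (NCTorus.torusTrace θ).applyRight k x ∧
        (NCTorus.torusTrace θ).integralOperator k ((NCTorus.torusTrace θ).incl x) =
          (NCTorus.torusTrace θ).applyLeft k x) ∧
    ∀ r : ℝ, 2 * d / (d + 2 * (α₁ + α₂)) < r →
      NCTorus.IsSchatten r ((NCTorus.torusTrace θ).integralOperator k) := by
  refine ⟨fun x => ⟨NCTorus.TracialState.integralOperator_incl _ k x, ?_⟩, fun r hr => ?_⟩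
  · rw [NCTorus.TracialState.integralOperator_incl, NCTorus.TracialState.applyRight_eq_applyLeft]
  · obtain ⟨h, hh⟩ := hk
    obtain ⟨K, hK⟩ := NCTorus.exists_approximation_of_weighted_matrix (by omega)
      (NCTorus.fourierBasis θ) ((NCTorus.torusTrace θ).integralOperator k) hα₁ hα₂
      (NCTorus.sum_weighted_matrix_le θ hh)
    have hd0 : (0 : ℝ) < d := by exact_mod_cast (by omega : 0 < d)
    have hden : 0 < (d : ℝ) + 2 * (α₁ + α₂) := by positivity
    have hr0 : 0 < r := lt_of_le_of_lt (by positivity) hr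
    refine NCTorus.isSchatten_of_approximation _ (by positivity) hr0 ?_ hK
    rw [div_lt_iff₀ hden] at hr
    -- This rewrites the summability condition `p r > 1` as the stated lower bound on `r`.
    have : ((α₁ + α₂) / d + 1 / 2) * r = r * (d + 2 * (α₁ + α₂)) / (2 * d) := by
      field_simp
      ring
    rw [this, lt_div_iff₀ (by positivity)]
    linarith
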